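/- **Setting.** Let $K$ streams $X_k=\{X_k(n):n\in\mathbb N\}$, $k\in[K]=\{1,\dots,K\}$, $\mathbb N=\{1,2,\dots\}$, be given, $X_k$ taking values in an arbitrary measurable space, and let $\mathcal F_k(n)=\sigma(X_k(1),\dots,X_k(n))$, $\mathcal F(n)=\sigma(\mathcal F_k(n),k\in[K])$. For each $k$ let $\mathrm P_k^0,\mathrm P_k^1$ be two laws of $X_k$ that are mutually absolutely continuous on $\mathcal F_k(n)$ for every $n$, with log-likelihood ratio $\lambda_k(n)=\log\frac{d\mathrm P_k^1}{d\mathrm P_k^0}(\mathcal F_k(n))$. For $A\subseteq[K]$ (the set of signals) let $\mathrm P_A$ be the law of $(X_1,\dots,X_K)$ under which the streams are independent, $X_k$ having law $\mathrm P_k^1$ if $k\in A$ and $\mathrm P_k^0$ if $k\notin A$; $\mathrm E_A$ is the expectation under $\mathrm P_A$. Assume that there are positive numbers $I_k,J_k$ such that for every $k\in[K]$ $$\mathrm P_k^1\Big(\limsup_n \tfrac{\lambda_k(n)}n\le I_k\Big)=1,\qquad \mathrm P_k^0\Big(\limsup_n \tfrac{-\lambda_k(n)}n\le J_k\Big)=1,$$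 $$\sum_{n\ge1}\mathrm P_k^1\Big(\tfrac{\lambda_k(n)}n\le I_k-\epsilon\Big)<\infty,\qquad \sum_{n\ge1}\mathrm P_k^0\Big(\tfrac{-\lambda_k(n)}n\le J_k-\epsilon\Big)<\infty\qquad\text{for all }\epsilon>0.$$ A *procedure* $\chi=(\mathbf T,\mathbf D)$ consists of random times $T_k\in\mathbb N\cup\{\infty\}$ and decisions $D_k\in\{0,1\}$ with $\{T_k=n\},\{T_k=n,D_k=i\}\in\mathcal F(n)$ for all $k\in[K]$, $n\in\mathbb N$, $i\in\{0,1\}$; it is *decentralized* ($\chi\in\Delta'$) if $\mathcal F(n)$ can be replaced by $\mathcal F_k(n)$. For a class $\Pi$ of subsets of $[K]$ and $\alpha,\beta\in(0,1)$, $\Delta(\alpha,\beta,\Pi)$ is the set of procedures such that, for every $A\in\Pi$, $\mathrm P_A(T_k<\infty)=1$ for all $k\in[K]$, $\mathrm P_A(\exists j\notin A: D_j=1)\le\alpha$ and $\mathrm P_A(\exists i\in A: D_i=0)\le\beta$. Let $$\mathcal L'_{k,A}(\alpha,\beta,\Pi)=\inf\{\mathrm E_A[T_k]:(\mathbf T,\mathbf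 D)\in\Delta'\cap\Delta(\alpha,\beta,\Pi)\}.$$ The *parallel SPRT* $\tilde\chi=(\tilde{\mathbf T},\tilde{\mathbf D})$ with thresholds $a,b>0$ is $\tilde T_k=\inf\{n\in\mathbb N:\lambda_k(n)\notin(-b,a)\}$, $\tilde D_k=\mathbf 1\{\tilde T_k<\infty,\ \lambda_k(\tilde T_k)\ge a\}$. All limits are as $\alpha,\beta\downarrow0$ jointly, with no relation imposed between $\alpha$ and $\beta$, and $x\sim y$ means $x/y\to1$. **Theorem.** Let $\Pi$ be such that for every $k\in[K]$ there are $A,B\in\Pi$ with $k\in A$ and $k\notin B$. Suppose that the thresholds $a=a(\alpha,\beta)>0$, $b=b(\alpha,\beta)>0$ are such that $\tilde\chi\in\Delta(\alpha,\beta,\Pi)$ for all $\alpha,\beta\in(0,1)$, and $a\sim|\log\alpha|$, $b\sim|\log\beta|$. Then $\tilde\chi\in\Delta'\cap\Delta(\alpha,\beta,\Pi)$ for all $\alpha,\beta\in(0,1)$ and, for every $A\in\Pi$, $i\in A$, $j\notin A$, $$\mathrm E_A[\tilde T_i]\sim\mathcal L'_{i,A}(\alpha,\beta,\Pi)\sim\frac{|\log\alpha|}{I_i},\qquad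 \mathrm E_A[\tilde T_j]\sim\mathcal L'_{j,A}(\alpha,\beta,\Pi)\sim\frac{|\log\beta|}{J_j}.$$ Moreover, the thresholds $a=|\log\alpha|+\log\max_{A\in\Pi}|A^c|$, $b=|\log\beta|+\log\max_{A\in\Pi}|A|$ satisfy these requirements. -/

import Mathlib

open MeasureTheory Filter Topology
open scoped ENNReal

namespace MultiTest

/-- The `σ`-algebra on a sequence space generated by the first `n` observations. The observation
made at time `t = 1, 2, …` is the coordinate with index `t - 1`. -/
@[reducible] def streamSigma (S : Type*) [MeasurableSpace S] (n : ℕ) : MeasurableSpace (ℕ → S) :=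
  MeasurableSpace.comap (fun (x : ℕ → S) (i : Fin n) => x i) MeasurableSpace.pi

theorem streamSigma_le (S : Type*) [MeasurableSpace S] (n : ℕ) :
    streamSigma S n ≤ (MeasurableSpace.pi : MeasurableSpace (ℕ → S)) :=
  Measurable.comap_le (measurable_pi_lambda _ fun i => measurable_pi_apply (i : ℕ))

/-- The log-likelihood ratio `log (dP₁/dP₀)` of the restrictions of `P₁` and `P₀` to the
`σ`-algebra of the first `n` observations of a stream. -/
noncomputable def lam {S : Type*} [MeasurableSpace S] (P₀ P₁ : Measure (ℕ → S)) (n : ℕ)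
    (x : ℕ → S) : ℝ :=
  llr (P₁.trim (streamSigma_le S n)) (P₀.trim (streamSigma_le S n)) x

/-- `P₀` and `P₁` are mutually absolutely continuous on the first `n` observations, for all `n`
(for `n = 0` this is automatic for probability measures). -/
def LocallyEquivalent {S : Type*} [MeasurableSpace S] (P₀ P₁ : Measure (ℕ → S)) : Prop :=
  ∀ n : ℕ,
    P₁.trim (streamSigma_le S n) ≪ P₀.trim (streamSigma_le S n) ∧
    P₀.trim (streamSigma_le S n) ≪ P₁.trim (streamSigma_le S n)

/-- Almost surely, `limsup λ(n)/n ≤ I` under `P₁` and `limsup (-λ(n))/n ≤ J` under `P₀`. The upper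
limits are taken in `[-∞, ∞]`. -/
def LimsupBound {S : Type*} [MeasurableSpace S] (P₀ P₁ : Measure (ℕ → S)) (I J : ℝ) : Prop :=
  (∀ᵐ x ∂P₁, limsup (fun n : ℕ => ((lam P₀ P₁ n x / n : ℝ) : EReal)) atTop ≤ (I : EReal)) ∧
  (∀ᵐ x ∂P₀, limsup (fun n : ℕ => ((-lam P₀ P₁ n x / n : ℝ) : EReal)) atTop ≤ (J : EReal))

/-- One-sided complete convergence of `λ(n)/n` to `I` under `P₁` and of `-λ(n)/n` to `J` under
`P₀`, both from below. -/
def CompleteLowerConvergence {S : Type*} [MeasurableSpace S] (P₀ P₁ : Measure (ℕ → S))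
    (I J : ℝ) : Prop :=
  (∀ ε : ℝ, 0 < ε →
    ∑' n : ℕ, P₁ {x | lam P₀ P₁ (n + 1) x / ((n + 1 : ℕ) : ℝ) ≤ I - ε} < ∞) ∧
  (∀ ε : ℝ, 0 < ε →
    ∑' n : ℕ, P₀ {x | -lam P₀ P₁ (n + 1) x / ((n + 1 : ℕ) : ℝ) ≤ J - ε} < ∞)

/-- The space of joint trajectories of the `K` streams; stream `k` takes values in `E k`. -/
abbrev Paths {K : ℕ} (E : Fin K → Type*) : Type _ := ∀ k : Fin K, ℕ → E k

section Streams

variable {K : ℕ} {E : Fin K → Type*} [∀ k, MeasurableSpace (E k)]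

variable (E) in
/-- `𝓕ₖ(n)`: generated by the first `n` observations of stream `k`. -/
@[reducible] def localSigma (k : Fin K) (n : ℕ) : MeasurableSpace (Paths E) :=
  MeasurableSpace.comap (fun ω : Paths E => ω k) (streamSigma (E k) n)

variable (E) in
/-- `𝓕(n)`: generated by the first `n` observations of all streams. -/
@[reducible] def globalSigma (n : ℕ) : MeasurableSpace (Paths E) :=
  ⨆ k : Fin K, localSigma E k n

/-- The joint law of the streams when the set of signals is `A`: the streams are independent, with
law `P₁ k` for `k ∈ A` and `P₀ k` for `k ∉ A`. -/
noncomputable def jointLaw (P₀ P₁ : ∀ k, Measure (ℕ → E k)) (A : Finset (Fin K)) :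
    Measure (Paths E) :=
  Measure.pi fun k => if k ∈ A then P₁ k else P₀ k

variable (E) in
/-- A vector of decision times (with values in `ℕ ∪ {∞}`) and a vector of decisions, where
`D k ω = true` means that stream `k` is identified as a signal. -/
structure Procedure where
  T : Fin K → Paths E → ℕ∞
  D : Fin K → Paths E → Bool

variable (E) in
/-- `Δ`: sequential multiple testing procedures. -/
def sequentialProcedures : Set (Procedure E) :=
  {χ | ∀ k : Fin K, (∀ ω, 1 ≤ χ.T k ω) ∧ ∀ n : ℕ, 1 ≤ n →
    MeasurableSet[globalSigma E n] {ω | χ.T k ω = n} ∧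
    ∀ i : Bool, MeasurableSet[globalSigma E n] {ω | χ.T k ω = n ∧ χ.D k ω = i}}

variable (E) in
/-- `Δ'`: decentralized procedures. -/
def decentralizedProcedures : Set (Procedure E) :=
  {χ | ∀ k : Fin K, (∀ ω, 1 ≤ χ.T k ω) ∧ ∀ n : ℕ, 1 ≤ n →
    MeasurableSet[localSigma E k n] {ω | χ.T k ω = n} ∧
    ∀ i : Bool, MeasurableSet[localSigma E k n] {ω | χ.T k ω = n ∧ χ.D k ω = i}}

/-- Type-I familywise error rate when the set of signals is `A`. -/
noncomputable def FWE1 (P₀ P₁ : ∀ k, Measure (ℕ → E k)) (A : Finset (Fin K))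
    (χ : Procedure E) : ℝ≥0∞ :=
  jointLaw P₀ P₁ A {ω | ∃ j, j ∉ A ∧ χ.D j ω = true}

/-- Type-II familywise error rate when the set of signals is `A`. -/
noncomputable def FWE2 (P₀ P₁ : ∀ k, Measure (ℕ → E k)) (A : Finset (Fin K))
    (χ : Procedure E) : ℝ≥0∞ :=
  jointLaw P₀ P₁ A {ω | ∃ i, i ∈ A ∧ χ.D i ω = false}

/-- `Δ(α, β, 𝒜)`: sequential multiple testing procedures that, under every signal configuration in
the class `𝒜`, terminate almost surely in every stream and have familywise error rates at most
`α` (type I) and `β` (type II). -/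
def controlledProcedures (P₀ P₁ : ∀ k, Measure (ℕ → E k)) (𝒜 : Finset (Finset (Fin K)))
    (α β : ℝ) : Set (Procedure E) :=
  {χ | χ ∈ sequentialProcedures E ∧ ∀ A ∈ 𝒜,
    (∀ k, ∀ᵐ ω ∂(jointLaw P₀ P₁ A), χ.T k ω < ⊤) ∧
    FWE1 P₀ P₁ A χ ≤ ENNReal.ofReal α ∧ FWE2 P₀ P₁ A χ ≤ ENNReal.ofReal β}

/-- Expected decision time in stream `k` when the set of signals is `A`. -/
noncomputable def expectedTime (P₀ P₁ : ∀ k, Measure (ℕ → E k)) (A : Finset (Fin K))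
    (χ : Procedure E) (k : Fin K) : ℝ≥0∞ :=
  ∫⁻ ω, (χ.T k ω : ℝ≥0∞) ∂(jointLaw P₀ P₁ A)

/-- `𝓛'_{k,A}(α, β, 𝒜)`: the smallest expected decision time in stream `k`, when the set of signals
is `A`, over the decentralized procedures in `Δ(α, β, 𝒜)` (`∞` if there are none). -/
noncomputable def optDecentralized (P₀ P₁ : ∀ k, Measure (ℕ → E k))
    (𝒜 : Finset (Finset (Fin K))) (A : Finset (Fin K)) (k : Fin K) (α β : ℝ) : ℝ≥0∞ :=
  ⨅ χ ∈ decentralizedProcedures E ∩ controlledProcedures P₀ P₁ 𝒜 α β, expectedTime P₀ P₁ A χ k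

open Classical in
/-- The parallel SPRT with thresholds `a, b`. In stream `k` it stops at the first `n ≥ 1` with
`λₖ(n) ∉ (-b, a)` (at `∞` if there is none), and identifies the stream as a signal if and only if
it has stopped with `λₖ ≥ a`. -/
noncomputable def parallelSPRT (P₀ P₁ : ∀ k, Measure (ℕ → E k)) (a b : ℝ) : Procedure E where
  T k ω := ⨅ (n : ℕ) (_ : 1 ≤ n ∧ lam (P₀ k) (P₁ k) n (ω k) ∉ Set.Ioo (-b) a), (n : ℕ∞)
  D k ω := decide (∃ n : ℕ,
    (⨅ (m : ℕ) (_ : 1 ≤ m ∧ lam (P₀ k) (P₁ k) m (ω k) ∉ Set.Ioo (-b) a), (m : ℕ∞)) = n ∧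
    a ≤ lam (P₀ k) (P₁ k) n (ω k))

/-- Thresholds `a, b`, as functions of `α, β`, are positive, put the parallel SPRT in
`Δ(α, β, 𝒜)` for all `α, β ∈ (0, 1)`, and satisfy `a ∼ |log α|`, `b ∼ |log β|` as `α, β → 0`. -/
def Calibrated (P₀ P₁ : ∀ k, Measure (ℕ → E k)) (𝒜 : Finset (Finset (Fin K)))
    (a b : ℝ → ℝ → ℝ) : Prop :=
  (∀ α ∈ Set.Ioo (0 : ℝ) 1, ∀ β ∈ Set.Ioo (0 : ℝ) 1,
    0 < a α β ∧ 0 < b α β ∧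
    parallelSPRT P₀ P₁ (a α β) (b α β) ∈ controlledProcedures P₀ P₁ 𝒜 α β) ∧
  Tendsto (fun p : ℝ × ℝ => a p.1 p.2 / |Real.log p.1|) (𝓝[>] 0 ×ˢ 𝓝[>] 0) (𝓝 1) ∧
  Tendsto (fun p : ℝ × ℝ => b p.1 p.2 / |Real.log p.2|) (𝓝[>] 0 ×ˢ 𝓝[>] 0) (𝓝 1)

end Streams

/-- `u ∼ v` as `α, β ↓ 0` (jointly, with no relation between `α` and `β`): the ratio tends to `1`.
Since `x / 0` and `x / ∞` are `0` or `∞` in `[0, ∞]`, this forces `u` and `v` to be positive and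
finite for all small `α, β`. -/
def AsympEq (u v : ℝ → ℝ → ℝ≥0∞) : Prop :=
  Tendsto (fun p : ℝ × ℝ => u p.1 p.2 / v p.1 p.2) (𝓝[>] 0 ×ˢ 𝓝[>] 0) (𝓝 1)

end MultiTest

open MultiTest

namespace MultiTest

/-! Up to null events, a decentralized procedure acts on stream `i` as a sequential test of `P₀ i`
against `P₁ i`. If `i ∈ A` and `B` in the class omits `i`, control under `A` and `B` bounds the two
error probabilities of this test by `β` and `α`, however `A` and `B` differ in the other streams.

Lower bound: by change of measure, stopping with the decision "signal" while `λ ≤ c` has probability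
at most `e^c α` under `A`. Take `m` slightly below `|log α| / I i` and `c` slightly above `I i * m`.
Then `e^c α` vanishes, the limsup condition makes `λ > c` before time `m` unlikely, and the decision
"noise" has probability at most `β`. So the test runs beyond `m` with probability close to one, and
Markov's inequality bounds its mean (`IsLogLikelihood.mul_le_lintegral`,
`IsLogLikelihood.eventually_forall_le_lintegral`).

Upper bound: if the SPRT is still running at a time `n ≥ a / I'` with `I' < I i`, then `λ(n) / n ≤
I'`. The expected number of such `n` is finite by complete convergence, so the mean is at most `a /
I' + O(1)` (`lintegral_le_of_forall_lt`, `eventually_lintegral_le`). For noise streams the same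
arguments apply to `-λ`, with `α` and `β` exchanged. The explicit thresholds come from Wald's bounds
`e^{-a}`, `e^{-b}` and a union bound. -/

theorem measure_inter_llr_le {Ω : Type*} {m : MeasurableSpace Ω} (μ ν : Measure Ω)
    [IsFiniteMeasure μ] [IsFiniteMeasure ν] (h : μ ≪ ν) {F : Set Ω} (hF : MeasurableSet F)
    (c : ℝ) :
    μ (F ∩ {x | llr μ ν x ≤ c}) ≤ ENNReal.ofReal (Real.exp c) * ν F := by
  have hG : MeasurableSet (F ∩ {x | llr μ ν x ≤ c}) :=
    hF.inter (measurableSet_le (measurable_llr μ ν) measurable_const)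
  calc μ (F ∩ {x | llr μ ν x ≤ c})
      = ∫⁻ x in F ∩ {x | llr μ ν x ≤ c}, μ.rnDeriv ν x ∂ν :=
        (Measure.setLIntegral_rnDeriv h _).symm
    _ ≤ ∫⁻ _ in F ∩ {x | llr μ ν x ≤ c}, ENNReal.ofReal (Real.exp c) ∂ν := by
        refine setLIntegral_mono_ae measurable_const.aemeasurable ?_
        filter_upwards [Measure.rnDeriv_lt_top μ ν] with x hx hxG
        rw [← ENNReal.ofReal_toReal hx.ne]
        refine ENNReal.ofReal_le_ofReal ?_
        -- A zero density must be treated apart: there `Real.log 0 = 0` says nothing about its size,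
        -- but the bound is trivial.
        rcases (ENNReal.toReal_nonneg (a := μ.rnDeriv ν x)).eq_or_lt with h0 | h0
        · rw [← h0]; positivity
        · exact (Real.log_le_iff_le_exp h0).1 hxG.2
    _ ≤ ENNReal.ofReal (Real.exp c) * ν F := by
        rw [lintegral_const, Measure.restrict_apply_univ]
        gcongr
        exact Set.inter_subset_left

/-- `-llr ν μ` and `llr μ ν` agree `μ`-a.e., which is all that a `μ`-probability needs. Thus the
single process `lam` serves both directions of the change of measure. -/
theorem measure_inter_neg_llr_le {Ω : Type*} {m : MeasurableSpace Ω} (μ ν : Measure Ω)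
    [IsFiniteMeasure μ] [IsFiniteMeasure ν] (h : μ ≪ ν) {F : Set Ω}
    (hF : MeasurableSet F) (c : ℝ) :
    μ (F ∩ {x | -llr ν μ x ≤ c}) ≤ ENNReal.ofReal (Real.exp c) * ν F := by
  refine le_trans (le_of_eq (measure_congr ?_)) (measure_inter_llr_le μ ν h hF c)
  filter_upwards [neg_llr h] with x hx
  have hx' : -llr ν μ x = llr μ ν x := by rw [← hx, Pi.neg_apply, neg_neg]
  change (x ∈ F ∧ -llr ν μ x ≤ c) = (x ∈ F ∧ llr μ ν x ≤ c)
  rw [hx']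

/-- The process `ℓ` is adapted to `𝓕` and allows one to bound `Q`-probabilities by
`R`-probabilities in the way the log-likelihood ratio of `Q` against `R` does. -/
structure IsLogLikelihood {Ω : Type*} [mΩ : MeasurableSpace Ω] (Q R : Measure Ω)
    (𝓕 : ℕ → MeasurableSpace Ω) (ℓ : ℕ → Ω → ℝ) : Prop where
  le : ∀ n, 𝓕 n ≤ mΩ
  adapted : ∀ n, Measurable[𝓕 n] (ℓ n)
  measure_inter_le : ∀ n F c, MeasurableSet[𝓕 n] F →
    Q (F ∩ {ω | ℓ n ω ≤ c}) ≤ ENNReal.ofReal (Real.exp c) * R F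

theorem IsLogLikelihood.measurable {Ω : Type*} [mΩ : MeasurableSpace Ω] {Q R : Measure Ω}
    {𝓕 : ℕ → MeasurableSpace Ω} {ℓ : ℕ → Ω → ℝ} (h : IsLogLikelihood Q R 𝓕 ℓ) (n : ℕ) :
    Measurable (ℓ n) :=
  (h.adapted n).mono (h.le n) le_rfl

theorem IsLogLikelihood.comap {Ω Ω' : Type*} [MeasurableSpace Ω] [MeasurableSpace Ω']
    {Q R : Measure Ω} {Q' R' : Measure Ω'} {𝓕 : ℕ → MeasurableSpace Ω} {ℓ : ℕ → Ω → ℝ}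
    (h : IsLogLikelihood Q R 𝓕 ℓ) {f : Ω' → Ω} (hQ : MeasurePreserving f Q' Q)
    (hR : MeasurePreserving f R' R) :
    IsLogLikelihood Q' R' (fun n => (𝓕 n).comap f) (fun n ω => ℓ n (f ω)) where
  le n := (MeasurableSpace.comap_mono (h.le n)).trans hQ.measurable.comap_le
  adapted n := (h.adapted n).comp (comap_measurable f)
  measure_inter_le n F c := by
    rintro ⟨G, hG, rfl⟩
    have hm : MeasurableSet (G ∩ {x | ℓ n x ≤ c}) :=
      (h.le n _ hG).inter (measurableSet_le (h.measurable n) measurable_const)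
    have hb := h.measure_inter_le n G c hG
    rw [← hQ.measure_preimage hm.nullMeasurableSet,
      ← hR.measure_preimage (h.le n _ hG).nullMeasurableSet] at hb
    exact hb

/-! ### Change of measure on a single stream -/

section Stream

variable {S : Type*} [MeasurableSpace S] (P₀ P₁ : Measure (ℕ → S))

theorem measurable_lam (n : ℕ) : Measurable[streamSigma S n] (lam P₀ P₁ n) :=
  @measurable_llr _ (streamSigma S n) _ _

variable [IsProbabilityMeasure P₀] [IsProbabilityMeasure P₁]

theorem isLogLikelihood_lam (h : LocallyEquivalent P₀ P₁) :
    IsLogLikelihood P₁ P₀ (streamSigma S) (lam P₀ P₁) where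
  le := streamSigma_le S
  adapted := measurable_lam P₀ P₁
  measure_inter_le n F c hF := by
    have hb := measure_inter_llr_le (P₁.trim (streamSigma_le S n)) (P₀.trim (streamSigma_le S n))
      (h n).1 hF c
    rw [trim_measurableSet_eq _ hF, trim_measurableSet_eq] at hb
    · exact hb
    · exact MeasurableSet.inter hF (measurable_lam P₀ P₁ n measurableSet_Iic)

theorem isLogLikelihood_neg_lam (h : LocallyEquivalent P₀ P₁) :
    IsLogLikelihood P₀ P₁ (streamSigma S) (fun n x => -lam P₀ P₁ n x) where
  le := streamSigma_le S
  adapted n := (measurable_lam P₀ P₁ n).neg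
  measure_inter_le n F c hF := by
    have hb := measure_inter_neg_llr_le (P₀.trim (streamSigma_le S n))
      (P₁.trim (streamSigma_le S n)) (h n).2 hF c
    rw [trim_measurableSet_eq _ hF, trim_measurableSet_eq] at hb
    · exact hb
    · exact MeasurableSet.inter hF ((measurable_lam P₀ P₁ n).neg measurableSet_Iic)

end Stream

/-! ### Change of measure between joint laws -/

section Streams

variable {K : ℕ} {E : Fin K → Type*} [∀ k, MeasurableSpace (E k)]
  (P₀ P₁ : ∀ k, Measure (ℕ → E k))
  [∀ k, IsProbabilityMeasure (P₀ k)] [∀ k, IsProbabilityMeasure (P₁ k)]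

instance isProbabilityMeasure_marginal (A : Finset (Fin K)) (k : Fin K) :
    IsProbabilityMeasure (if k ∈ A then P₁ k else P₀ k) := by
  split_ifs <;> infer_instance

instance isProbabilityMeasure_jointLaw (A : Finset (Fin K)) :
    IsProbabilityMeasure (jointLaw P₀ P₁ A) := by
  unfold jointLaw; infer_instance

theorem measurePreserving_jointLaw_of_mem {A : Finset (Fin K)} {k : Fin K} (hk : k ∈ A) :
    MeasurePreserving (fun ω : Paths E => ω k) (jointLaw P₀ P₁ A) (P₁ k) := by
  have h := measurePreserving_eval (fun k => if k ∈ A then P₁ k else P₀ k) k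
  rwa [if_pos hk] at h

theorem measurePreserving_jointLaw_of_notMem {A : Finset (Fin K)} {k : Fin K} (hk : k ∉ A) :
    MeasurePreserving (fun ω : Paths E => ω k) (jointLaw P₀ P₁ A) (P₀ k) := by
  have h := measurePreserving_eval (fun k => if k ∈ A then P₁ k else P₀ k) k
  rwa [if_neg hk] at h

/-- This is where decentralization matters: events of stream `k` see only its marginal, so `A` and
`B` may differ arbitrarily in the other streams. -/
theorem isLogLikelihood_jointLaw (hac : ∀ k, LocallyEquivalent (P₀ k) (P₁ k))
    {A B : Finset (Fin K)} {k : Fin K} (hA : k ∈ A) (hB : k ∉ B) :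
    IsLogLikelihood (jointLaw P₀ P₁ A) (jointLaw P₀ P₁ B) (localSigma E k)
      (fun n ω => lam (P₀ k) (P₁ k) n (ω k)) :=
  (isLogLikelihood_lam _ _ (hac k)).comap (measurePreserving_jointLaw_of_mem P₀ P₁ hA)
    (measurePreserving_jointLaw_of_notMem P₀ P₁ hB)

theorem isLogLikelihood_neg_jointLaw (hac : ∀ k, LocallyEquivalent (P₀ k) (P₁ k))
    {A B : Finset (Fin K)} {k : Fin K} (hA : k ∈ A) (hB : k ∉ B) :
    IsLogLikelihood (jointLaw P₀ P₁ B) (jointLaw P₀ P₁ A) (localSigma E k)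
      (fun n ω => -lam (P₀ k) (P₁ k) n (ω k)) :=
  (isLogLikelihood_neg_lam _ _ (hac k)).comap (measurePreserving_jointLaw_of_notMem P₀ P₁ hB)
    (measurePreserving_jointLaw_of_mem P₀ P₁ hA)

end Streams

/-! ### Non-asymptotic bounds on the mean of a random time -/

section Abstract

variable {Ω : Type*} [mΩ : MeasurableSpace Ω] {Q R : Measure Ω} {𝓕 : ℕ → MeasurableSpace Ω}
  {ℓ : ℕ → Ω → ℝ}

theorem measurableSet_le_natCast {T : Ω → ℕ∞} (hT1 : ∀ ω, 1 ≤ T ω)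
    (hT : ∀ n : ℕ, 1 ≤ n → MeasurableSet {ω | T ω = n}) (m : ℕ) :
    MeasurableSet {ω | T ω ≤ m} := by
  have : {ω | T ω ≤ m} = ⋃ n ∈ Finset.Icc 1 m, {ω | T ω = n} := by
    ext ω
    simp only [Set.mem_ofPred_eq, Set.mem_iUnion, Finset.mem_Icc, exists_prop]
    constructor
    · intro hω
      have hn := ENat.natCast_toNat (ne_top_of_le_ne_top (ENat.natCast_ne_top m) hω)
      have h1 := hT1 ω
      rw [← hn] at hω h1
      exact ⟨(T ω).toNat, ⟨by exact_mod_cast h1, by exact_mod_cast hω⟩, hn.symm⟩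
    · rintro ⟨n, ⟨-, hn⟩, h⟩
      rw [h]
      exact_mod_cast hn
  rw [this]
  exact Finset.measurableSet_biUnion _ fun n hn => hT n (Finset.mem_Icc.1 hn).1

/-- Wald-type bound on the probability of an error committed at a random time. -/
theorem IsLogLikelihood.measure_iUnion_le (h : IsLogLikelihood Q R 𝓕 ℓ) {T : Ω → ℕ∞}
    {F : ℕ → Set Ω} (hF : ∀ n, 1 ≤ n → MeasurableSet[𝓕 n] (F n))
    (hFT : ∀ n, F n ⊆ {ω | T ω = n}) (c : ℝ) :
    Q (⋃ n : ℕ, F (n + 1) ∩ {ω | ℓ (n + 1) ω ≤ c}) ≤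
      ENNReal.ofReal (Real.exp c) * R (⋃ n : ℕ, F (n + 1)) := by
  calc Q (⋃ n : ℕ, F (n + 1) ∩ {ω | ℓ (n + 1) ω ≤ c})
      ≤ ∑' n : ℕ, Q (F (n + 1) ∩ {ω | ℓ (n + 1) ω ≤ c}) := MeasureTheory.measure_iUnion_le _
    _ ≤ ∑' n : ℕ, ENNReal.ofReal (Real.exp c) * R (F (n + 1)) :=
        ENNReal.tsum_le_tsum fun n => h.measure_inter_le _ _ _ (hF _ (by omega))
    _ = ENNReal.ofReal (Real.exp c) * R (⋃ n : ℕ, F (n + 1)) := by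
        -- The union is disjoint because its members lie in different level sets of `T`.
        rw [ENNReal.tsum_mul_left, measure_iUnion]
        · intro n n' hn
          refine Set.disjoint_left.2 fun ω h1 h2 => hn ?_
          have h3 : ((n + 1 : ℕ) : ℕ∞) = ((n' + 1 : ℕ) : ℕ∞) := (hFT _ h1).symm.trans (hFT _ h2)
          have h4 := Nat.cast_injective h3
          omega
        · exact fun n => h.le _ _ (hF _ (by omega))

/-- Lower bound on the expected decision time of a test of `R` against `Q`. -/
theorem IsLogLikelihood.mul_le_lintegral [IsProbabilityMeasure Q] (h : IsLogLikelihood Q R 𝓕 ℓ)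
    {T : Ω → ℕ∞} {D : Ω → Bool} {d : Bool} {x y : ℝ≥0∞} (hT1 : ∀ ω, 1 ≤ T ω)
    (hT : ∀ n : ℕ, 1 ≤ n → MeasurableSet[𝓕 n] {ω | T ω = n})
    (hTD : ∀ n : ℕ, 1 ≤ n → ∀ i, MeasurableSet[𝓕 n] {ω | T ω = n ∧ D ω = i})
    (hx : R {ω | D ω = d} ≤ x) (hy : Q {ω | D ω = !d} ≤ y) (m : ℕ) (c : ℝ) :
    (m : ℝ≥0∞) * (1 - (Q {ω | ∃ n ≤ m, c < ℓ n ω} + ENNReal.ofReal (Real.exp c) * x + y)) ≤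
      ∫⁻ ω, (T ω : ℝ≥0∞) ∂Q := by
  have hS : MeasurableSet {ω | T ω ≤ m} :=
    measurableSet_le_natCast hT1 (fun n hn => h.le n _ (hT n hn)) m
  -- Here `d` is the correct decision under `Q` and an error under `R`. Stopping by `m` requires
  -- that `ℓ` is large early, or that `d` is chosen with `ℓ ≤ c` (rare by change of measure), or an
  -- error under `Q`.
  have hsub : {ω | T ω ≤ m} ⊆ ({ω | ∃ n ≤ m, c < ℓ n ω} ∪
      ⋃ n : ℕ, {ω | T ω = (n + 1 : ℕ) ∧ D ω = d} ∩ {ω | ℓ (n + 1) ω ≤ c}) ∪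
      {ω | D ω = !d} := by
    intro ω hω
    obtain ⟨n, hn⟩ : ∃ n : ℕ, T ω = n :=
      ⟨(T ω).toNat, (ENat.natCast_toNat (ne_top_of_le_ne_top (ENat.natCast_ne_top m) hω)).symm⟩
    have hn1 : 1 ≤ n := by
      have := hT1 ω
      rw [hn] at this
      exact_mod_cast this
    have hnm : n ≤ m := by
      have : T ω ≤ m := hω
      rw [hn] at this
      exact_mod_cast this
    by_cases hD : D ω = d
    · left
      by_cases hc : ℓ n ω ≤ c
      · right
        obtain ⟨k, rfl⟩ : ∃ k, n = k + 1 := ⟨n - 1, by omega⟩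
        exact Set.mem_iUnion.2 ⟨k, ⟨hn, hD⟩, hc⟩
      · exact Or.inl ⟨n, hnm, not_le.1 hc⟩
    · right
      cases hd : D ω <;> cases d <;> simp_all
  have hle : Q {ω | T ω ≤ m} ≤
      Q {ω | ∃ n ≤ m, c < ℓ n ω} + ENNReal.ofReal (Real.exp c) * x + y := by
    refine (measure_mono hsub).trans ((measure_union_le _ _).trans (add_le_add ?_ hy))
    refine (measure_union_le _ _).trans (add_le_add le_rfl ?_)
    refine (h.measure_iUnion_le (F := fun n => {ω | T ω = n ∧ D ω = d})
      (fun n hn => hTD n hn d) (fun n ω hω => hω.1) c).trans ?_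
    gcongr
    refine (measure_mono ?_).trans hx
    exact Set.iUnion_subset fun n ω hω => hω.2
  calc (m : ℝ≥0∞) * (1 - (Q {ω | ∃ n ≤ m, c < ℓ n ω} + ENNReal.ofReal (Real.exp c) * x + y))
      ≤ m * (1 - Q {ω | T ω ≤ m}) := by gcongr
    _ = ∫⁻ ω, {ω | T ω ≤ m}ᶜ.indicator (fun _ => (m : ℝ≥0∞)) ω ∂Q := by
        rw [lintegral_indicator_const hS.compl, prob_compl_eq_one_sub hS]
    _ ≤ ∫⁻ ω, (T ω : ℝ≥0∞) ∂Q := by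
        refine lintegral_mono fun ω => ?_
        refine Set.indicator_apply_le' (fun hω => ?_) fun _ => zero_le
        have : ((m : ℕ∞) : ℝ≥0∞) ≤ (T ω : ℝ≥0∞) := ENat.toENNReal_le.2 (lt_of_not_ge fun h' => hω h').le
        simpa using this

/-- Almost surely `ℓ n < I' n ≤ I' m` for all `n` from some `N` up to `m`, and the finitely many
values before `N` are eventually below `I' m` since `I' > 0`. Pointwise convergence of indicators
then gives convergence of probabilities. -/
theorem tendsto_measure_exists_le_lt [IsFiniteMeasure Q] (hℓ : ∀ n, Measurable (ℓ n)) {I : ℝ}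
    (hlim : ∀ᵐ ω ∂Q, limsup (fun n : ℕ => ((ℓ n ω / n : ℝ) : EReal)) atTop ≤ (I : EReal))
    {I' : ℝ} (hI : I < I') (hI' : 0 < I') :
    Tendsto (fun m : ℕ => Q {ω | ∃ n ≤ m, I' * m < ℓ n ω}) atTop (𝓝 0) := by
  rw [← measure_empty (μ := Q)]
  refine tendsto_measure_of_ae_tendsto_indicator_of_isFiniteMeasure atTop MeasurableSet.empty
    (fun m => ?_) ?_
  · have : {ω | ∃ n ≤ m, I' * m < ℓ n ω} = ⋃ n ∈ Finset.Iic m, {ω | I' * m < ℓ n ω} := by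
      ext ω; simp
    rw [this]
    exact Finset.measurableSet_biUnion _ fun n _ => measurableSet_lt measurable_const (hℓ n)
  · filter_upwards [hlim] with ω hω
    have h1 : ∀ᶠ n : ℕ in atTop, ((ℓ n ω / n : ℝ) : EReal) < (I' : EReal) :=
      eventually_lt_of_limsup_lt (hω.trans_lt (by exact_mod_cast hI))
    obtain ⟨N, hN⟩ := eventually_atTop.1 (h1.and (eventually_ge_atTop 1))
    have h2 : Tendsto (fun m : ℕ => I' * (m : ℝ)) atTop atTop :=
      tendsto_natCast_atTop_atTop.const_mul_atTop hI'
    have h3 : ∀ᶠ m : ℕ in atTop, ∀ n ∈ Finset.range N, ℓ n ω ≤ I' * (m : ℝ) :=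
      (Finset.eventually_all _).2 fun n _ => h2.eventually_ge_atTop _
    filter_upwards [h3] with m hm
    simp only [Set.mem_empty_iff_false, iff_false, not_exists, not_and, not_lt]
    intro n hn
    by_cases hnN : n < N
    · exact hm n (Finset.mem_range.2 hnN)
    · obtain ⟨h4, h5⟩ := hN n (not_lt.1 hnN)
      have h6 : ℓ n ω / n < I' := by exact_mod_cast h4
      have h7 : (0 : ℝ) < n := by exact_mod_cast h5
      rw [div_lt_iff₀ h7] at h6
      refine h6.le.trans ?_
      gcongr

/-- Upper bound on the expectation of a random time by which `ℓ` has exceeded `a`. -/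
theorem lintegral_le_of_forall_lt (Q : Measure Ω) [IsProbabilityMeasure Q]
    (hℓ : ∀ n, Measurable (ℓ n)) {T : Ω → ℕ∞} {a : ℝ}
    (hT : ∀ ω (n : ℕ), 1 ≤ n → (n : ℕ∞) < T ω → ℓ n ω < a) {I' : ℝ} (hI' : 0 < I') (ha : 0 ≤ a) :
    ∫⁻ ω, (T ω : ℝ≥0∞) ∂Q ≤ ENNReal.ofReal (a / I' + 2) +
      ∑' n : ℕ, Q {ω | ℓ (n + 1) ω / ((n + 1 : ℕ) : ℝ) ≤ I'} := by
  set G : ℕ → Set Ω := fun n => {ω | ℓ (n + 1) ω / ((n + 1 : ℕ) : ℝ) ≤ I'} with hG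
  have hGm : ∀ n, MeasurableSet (G n) := fun n =>
    measurableSet_le ((hℓ _).div_const _) measurable_const
  set N : ℕ := ⌈a / I'⌉₊ with hN
  have hpt : ∀ ω, (T ω : ℝ≥0∞) ≤ ((N + 1 : ℕ) : ℝ≥0∞) +
      ∑' n, (G n).indicator (fun _ => (1 : ℝ≥0∞)) ω := by
    intro ω
    -- All times from `N + 1` to `M - 1` contribute to the sum, which leaves at most `N + 1` times
    -- uncounted. Stating this for natural `M ≤ T ω` also covers `T ω = ⊤`, by a supremum over `M`.
    have key : ∀ M : ℕ, (M : ℕ∞) ≤ T ω → (M : ℝ≥0∞) ≤ ((N + 1 : ℕ) : ℝ≥0∞) +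
        ∑' n, (G n).indicator (fun _ => (1 : ℝ≥0∞)) ω := by
      intro M hM
      have h1 : ∀ n ∈ Finset.Ico N (M - 1), (G n).indicator (fun _ => (1 : ℝ≥0∞)) ω = 1 := by
        intro n hn
        rw [Finset.mem_Ico] at hn
        have h2 := hT ω (n + 1) (by omega)
          (lt_of_lt_of_le (by exact_mod_cast (by omega : n + 1 < M)) hM)
        refine Set.indicator_of_mem ?_ _
        have h3 : (0 : ℝ) < ((n + 1 : ℕ) : ℝ) := by positivity
        have h4 : a / I' ≤ ((n + 1 : ℕ) : ℝ) :=
          (Nat.le_ceil _).trans (by exact_mod_cast (by omega : N ≤ n + 1))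
        rw [div_le_iff₀ hI'] at h4
        change ℓ (n + 1) ω / ((n + 1 : ℕ) : ℝ) ≤ I'
        rw [div_le_iff₀ h3]
        linarith
      have h5 := ENNReal.sum_le_tsum (f := fun n => (G n).indicator (fun _ => (1 : ℝ≥0∞)) ω)
        (Finset.Ico N (M - 1))
      rw [Finset.sum_congr rfl h1, Finset.sum_const, Nat.card_Ico, nsmul_eq_mul, mul_one] at h5
      refine le_trans ?_ (add_le_add le_rfl h5)
      exact_mod_cast (by omega : M ≤ N + 1 + (M - 1 - N))
    rcases eq_or_ne (T ω) ⊤ with hω | hω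
    · refine (le_of_eq_of_le ?_ (iSup_le fun M : ℕ => key M (hω ▸ le_top)))
      rw [hω, ENat.toENNReal_top, ENNReal.iSup_natCast]
    · have h6 := key (T ω).toNat (ENat.natCast_toNat hω).le
      rwa [← ENat.toENNReal_coe, ENat.natCast_toNat hω] at h6
  calc ∫⁻ ω, (T ω : ℝ≥0∞) ∂Q
      ≤ ∫⁻ ω, ((N + 1 : ℕ) : ℝ≥0∞) + ∑' n, (G n).indicator (fun _ => (1 : ℝ≥0∞)) ω ∂Q :=
        lintegral_mono hpt
    _ = ((N + 1 : ℕ) : ℝ≥0∞) + ∑' n, Q (G n) := by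
        rw [lintegral_add_left measurable_const, lintegral_const, measure_univ, mul_one,
          lintegral_tsum fun n => (measurable_const.indicator (hGm n)).aemeasurable]
        congr 1
        refine tsum_congr fun n => ?_
        rw [lintegral_indicator_const (hGm n), one_mul]
    _ ≤ ENNReal.ofReal (a / I' + 2) + ∑' n, Q (G n) := by
        -- In `a / I' + 2`, one unit pays for the ceiling and one for the stopping time itself.
        gcongr
        rw [← ENNReal.ofReal_natCast]
        refine ENNReal.ofReal_le_ofReal ?_
        push_cast
        linarith [Nat.ceil_lt_add_one (div_nonneg ha hI'.le)]

end Abstract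

/-! ### The parallel SPRT: measurability, termination, error probabilities -/

theorem iInf_natCast_eq_iff {p : ℕ → Prop} {n : ℕ} :
    (⨅ (m : ℕ) (_ : p m), (m : ℕ∞)) = n ↔ p n ∧ ∀ m < n, ¬p m := by
  constructor
  · intro h
    have hlt : ∀ m < n, ¬p m := by
      intro m hm hp
      have h1 : (⨅ (m : ℕ) (_ : p m), (m : ℕ∞)) ≤ m := iInf₂_le m hp
      rw [h] at h1
      exact absurd (Nat.cast_le.1 h1) (by omega)
    refine ⟨?_, hlt⟩
    by_contra hn
    have h2 : ((n + 1 : ℕ) : ℕ∞) ≤ ⨅ (m : ℕ) (_ : p m), (m : ℕ∞) := by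
      refine le_iInf₂ fun m hm => Nat.cast_le.2 ?_
      by_contra hmn
      rcases (show m < n ∨ m = n by omega) with h3 | rfl
      · exact hlt m h3 hm
      · exact hn hm
    rw [h] at h2
    exact absurd (Nat.cast_le.1 h2) (by omega)
  · rintro ⟨hn, h⟩
    refine le_antisymm (iInf₂_le n hn) (le_iInf₂ fun m hm => Nat.cast_le.2 ?_)
    by_contra h'
    exact h m (not_le.1 h') hm

theorem not_of_natCast_lt_iInf {p : ℕ → Prop} {n : ℕ}
    (h : (n : ℕ∞) < ⨅ (m : ℕ) (_ : p m), (m : ℕ∞)) : ¬p n :=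
  fun hp => absurd (iInf₂_le n hp) (not_le.2 h)

theorem streamSigma_mono (S : Type*) [MeasurableSpace S] : Monotone (streamSigma S) := by
  intro m n hmn
  have h : (fun (x : ℕ → S) (i : Fin m) => x i) =
      (fun (y : Fin n → S) (i : Fin m) => y (Fin.castLE hmn i)) ∘ fun x i => x i := rfl
  unfold streamSigma
  rw [h, ← MeasurableSpace.comap_comp]
  refine MeasurableSpace.comap_mono (Measurable.comap_le ?_)
  exact measurable_pi_lambda _ fun i => measurable_pi_apply _

/-- Complete convergence from below forces the process to exceed every level. -/
theorem ae_exists_le_of_tsum_lt_top {Ω : Type*} [MeasurableSpace Ω] {Q : Measure Ω}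
    {ℓ : ℕ → Ω → ℝ} {I' : ℝ} (hI' : 0 < I')
    (h : ∑' n : ℕ, Q {ω | ℓ (n + 1) ω / ((n + 1 : ℕ) : ℝ) ≤ I'} < ∞) (a : ℝ) :
    ∀ᵐ ω ∂Q, ∃ n, 1 ≤ n ∧ a ≤ ℓ n ω := by
  have h1 := ae_eventually_notMem h.ne
  filter_upwards [h1] with ω hω
  have h2 : Tendsto (fun n : ℕ => I' * ((n + 1 : ℕ) : ℝ)) atTop atTop :=
    (tendsto_natCast_atTop_atTop.comp (tendsto_add_atTop_nat 1)).const_mul_atTop hI'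
  obtain ⟨n, hn, hna⟩ := (hω.and (h2.eventually_ge_atTop a)).exists
  refine ⟨n + 1, by omega, hna.trans ?_⟩
  have h3 : I' < ℓ (n + 1) ω / ((n + 1 : ℕ) : ℝ) := not_le.1 hn
  rw [lt_div_iff₀ (by positivity)] at h3
  exact h3.le

section Streams

variable {K : ℕ} {E : Fin K → Type*} [∀ k, MeasurableSpace (E k)]

theorem localSigma_mono (k : Fin K) : Monotone (localSigma E k) :=
  fun _ _ h => MeasurableSpace.comap_mono (streamSigma_mono (E k) h)

theorem decentralizedProcedures_subset :
    decentralizedProcedures E ⊆ sequentialProcedures E := fun _ hχ k =>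
  ⟨(hχ k).1, fun n hn => ⟨le_iSup (fun k => localSigma E k n) k _ ((hχ k).2 n hn).1,
    fun i => le_iSup (fun k => localSigma E k n) k _ (((hχ k).2 n hn).2 i)⟩⟩

variable (P₀ P₁ : ∀ k, Measure (ℕ → E k))

theorem measurable_lam_apply (k : Fin K) (n : ℕ) :
    Measurable[localSigma E k n] fun ω : Paths E => lam (P₀ k) (P₁ k) n (ω k) :=
  (measurable_lam (P₀ k) (P₁ k) n).comp (comap_measurable _)

theorem parallelSPRT_T_eq_iff {a b : ℝ} {k : Fin K} {ω : Paths E} {n : ℕ} :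
    (parallelSPRT P₀ P₁ a b).T k ω = n ↔
      (1 ≤ n ∧ lam (P₀ k) (P₁ k) n (ω k) ∉ Set.Ioo (-b) a) ∧
        ∀ m < n, ¬(1 ≤ m ∧ lam (P₀ k) (P₁ k) m (ω k) ∉ Set.Ioo (-b) a) :=
  iInf_natCast_eq_iff (p := fun n => 1 ≤ n ∧ lam (P₀ k) (P₁ k) n (ω k) ∉ Set.Ioo (-b) a)

theorem mem_Ioo_of_lt_parallelSPRT_T {a b : ℝ} {k : Fin K} {ω : Paths E} {n : ℕ} (hn : 1 ≤ n)
    (h : (n : ℕ∞) < (parallelSPRT P₀ P₁ a b).T k ω) :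
    lam (P₀ k) (P₁ k) n (ω k) ∈ Set.Ioo (-b) a := by
  by_contra h'
  exact not_of_natCast_lt_iInf
    (p := fun n => 1 ≤ n ∧ lam (P₀ k) (P₁ k) n (ω k) ∉ Set.Ioo (-b) a) h ⟨hn, h'⟩

theorem parallelSPRT_D_eq_true_iff {a b : ℝ} {k : Fin K} {ω : Paths E} :
    (parallelSPRT P₀ P₁ a b).D k ω = true ↔
      ∃ n : ℕ, (parallelSPRT P₀ P₁ a b).T k ω = n ∧ a ≤ lam (P₀ k) (P₁ k) n (ω k) :=
  @decide_eq_true_iff _ (Classical.propDecidable _)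

theorem parallelSPRT_D_eq_true_iff_of_T_eq {a b : ℝ} {k : Fin K} {ω : Paths E} {n : ℕ}
    (h : (parallelSPRT P₀ P₁ a b).T k ω = n) :
    (parallelSPRT P₀ P₁ a b).D k ω = true ↔ a ≤ lam (P₀ k) (P₁ k) n (ω k) := by
  rw [parallelSPRT_D_eq_true_iff]
  constructor
  · rintro ⟨m, hm, hle⟩
    obtain rfl : n = m := Nat.cast_injective (h.symm.trans hm)
    exact hle
  · exact fun hle => ⟨n, h, hle⟩

/-- Stopping at `n` means staying inside the interval at times `1, …, n - 1` and being outside at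
`n`, which the first `n` observations of the stream determine. -/
theorem parallelSPRT_mem_decentralizedProcedures (a b : ℝ) :
    parallelSPRT P₀ P₁ a b ∈ decentralizedProcedures E := by
  intro k
  refine ⟨fun ω => le_iInf₂ fun n hn => by exact_mod_cast hn.1, fun n hn => ?_⟩
  have hT : MeasurableSet[localSigma E k n] {ω | (parallelSPRT P₀ P₁ a b).T k ω = n} := by
    have heq : {ω | (parallelSPRT P₀ P₁ a b).T k ω = n} =
        {ω : Paths E | lam (P₀ k) (P₁ k) n (ω k) ∉ Set.Ioo (-b) a} ∩
          ⋂ m ∈ Finset.Ico 1 n, {ω : Paths E | lam (P₀ k) (P₁ k) m (ω k) ∈ Set.Ioo (-b) a} := by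
      ext ω
      simp only [Set.mem_ofPred_eq, parallelSPRT_T_eq_iff, Set.mem_inter_iff, Set.mem_iInter,
        Finset.mem_Ico, hn, true_and, not_and, not_not]
      exact and_congr_right fun _ => ⟨fun h m hm => h m hm.2 hm.1, fun h m h1 h2 => h m ⟨h2, h1⟩⟩
    rw [heq]
    refine MeasurableSet.inter (measurable_lam_apply P₀ P₁ k n measurableSet_Ioo).compl ?_
    refine Finset.measurableSet_biInter _ fun m hm => ?_
    exact localSigma_mono k (Finset.mem_Ico.1 hm).2.le _
      (measurable_lam_apply P₀ P₁ k m measurableSet_Ioo)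
  refine ⟨hT, fun i => ?_⟩
  have hA : MeasurableSet[localSigma E k n] {ω : Paths E | a ≤ lam (P₀ k) (P₁ k) n (ω k)} :=
    measurable_lam_apply P₀ P₁ k n measurableSet_Ici
  cases i with
  | true =>
    convert MeasurableSet.inter hT hA using 1
    ext ω
    exact and_congr_right fun h => parallelSPRT_D_eq_true_iff_of_T_eq P₀ P₁ h
  | false =>
    convert MeasurableSet.inter hT hA.compl using 1
    ext ω
    refine and_congr_right fun h => ?_
    rw [← Bool.not_eq_true]
    exact not_congr (parallelSPRT_D_eq_true_iff_of_T_eq P₀ P₁ h)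

variable [∀ k, IsProbabilityMeasure (P₀ k)] [∀ k, IsProbabilityMeasure (P₁ k)]

variable {P₀ P₁} in
theorem tsum_jointLaw_lt_top_of_mem {I J : Fin K → ℝ}
    (hcomplete : ∀ k, CompleteLowerConvergence (P₀ k) (P₁ k) (I k) (J k))
    {A : Finset (Fin K)} {i : Fin K} (hi : i ∈ A) {ε : ℝ} (hε : 0 < ε) :
    ∑' n : ℕ, jointLaw P₀ P₁ A
      {ω | lam (P₀ i) (P₁ i) (n + 1) (ω i) / ((n + 1 : ℕ) : ℝ) ≤ I i - ε} < ∞ := by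
  refine lt_of_eq_of_lt (tsum_congr fun n => ?_) ((hcomplete i).1 ε hε)
  refine (measurePreserving_jointLaw_of_mem P₀ P₁ hi).measure_preimage
    (s := {x | lam (P₀ i) (P₁ i) (n + 1) x / ((n + 1 : ℕ) : ℝ) ≤ I i - ε})
    (MeasurableSet.nullMeasurableSet ?_)
  exact measurableSet_le (((measurable_lam _ _ _).mono (streamSigma_le _ _) le_rfl).div_const _)
    measurable_const

variable {P₀ P₁} in
theorem tsum_jointLaw_lt_top_of_notMem {I J : Fin K → ℝ}
    (hcomplete : ∀ k, CompleteLowerConvergence (P₀ k) (P₁ k) (I k) (J k))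
    {A : Finset (Fin K)} {j : Fin K} (hj : j ∉ A) {ε : ℝ} (hε : 0 < ε) :
    ∑' n : ℕ, jointLaw P₀ P₁ A
      {ω | -lam (P₀ j) (P₁ j) (n + 1) (ω j) / ((n + 1 : ℕ) : ℝ) ≤ J j - ε} < ∞ := by
  refine lt_of_eq_of_lt (tsum_congr fun n => ?_) ((hcomplete j).2 ε hε)
  refine (measurePreserving_jointLaw_of_notMem P₀ P₁ hj).measure_preimage
    (s := {x | -lam (P₀ j) (P₁ j) (n + 1) x / ((n + 1 : ℕ) : ℝ) ≤ J j - ε})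
    (MeasurableSet.nullMeasurableSet ?_)
  exact measurableSet_le
    (((measurable_lam _ _ _).mono (streamSigma_le _ _) le_rfl).neg.div_const _) measurable_const

theorem parallelSPRT_T_lt_top {I J : Fin K → ℝ} (hI : ∀ k, 0 < I k) (hJ : ∀ k, 0 < J k)
    (hcomplete : ∀ k, CompleteLowerConvergence (P₀ k) (P₁ k) (I k) (J k))
    (A : Finset (Fin K)) (a b : ℝ) (k : Fin K) :
    ∀ᵐ ω ∂(jointLaw P₀ P₁ A), (parallelSPRT P₀ P₁ a b).T k ω < ⊤ := by
  have key : ∀ ω : Paths E, (∃ n, 1 ≤ n ∧ lam (P₀ k) (P₁ k) n (ω k) ∉ Set.Ioo (-b) a) →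
      (parallelSPRT P₀ P₁ a b).T k ω < ⊤ := by
    rintro ω ⟨n, h1, hn⟩
    by_contra h
    rw [not_lt_top_iff] at h
    exact hn (mem_Ioo_of_lt_parallelSPRT_T P₀ P₁ h1 (h ▸ ENat.natCast_lt_top n))
  by_cases hk : k ∈ A
  -- Half of `I k` is an arbitrary choice: the remaining drift only has to be positive.
  · have h := tsum_jointLaw_lt_top_of_mem hcomplete hk (half_pos (hI k))
    filter_upwards [ae_exists_le_of_tsum_lt_top (ℓ := fun n ω => lam (P₀ k) (P₁ k) n (ω k))
      (by linarith [hI k]) h a] with ω ⟨n, h1, hn⟩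
    exact key ω ⟨n, h1, fun h' => absurd h'.2 (not_lt.2 hn)⟩
  · have h : ∀ᵐ ω ∂(jointLaw P₀ P₁ A), ∃ n, 1 ≤ n ∧ b ≤ -lam (P₀ k) (P₁ k) n (ω k) := by
      refine ae_exists_le_of_tsum_lt_top (ℓ := fun n (ω : Paths E) => -lam (P₀ k) (P₁ k) n (ω k))
        (sub_pos.2 (half_lt_self (hJ k))) ?_ b
      exact tsum_jointLaw_lt_top_of_notMem hcomplete hk (half_pos (hJ k))
    filter_upwards [h] with ω ⟨n, h1, hn⟩
    exact key ω ⟨n, h1, fun h' => absurd h'.1 (by linarith)⟩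

/-- Wald's argument against any law for which `j` is a signal, here the one where all streams are.
Termination is not needed, since the decision "signal" presupposes a finite time. -/
theorem jointLaw_parallelSPRT_D_eq_true_le (hac : ∀ k, LocallyEquivalent (P₀ k) (P₁ k))
    {A : Finset (Fin K)} {j : Fin K} (hj : j ∉ A) (a b : ℝ) :
    jointLaw P₀ P₁ A {ω | (parallelSPRT P₀ P₁ a b).D j ω = true} ≤
      ENNReal.ofReal (Real.exp (-a)) := by
  have h := isLogLikelihood_neg_jointLaw P₀ P₁ hac (Finset.mem_univ j) hj
  have hχ := parallelSPRT_mem_decentralizedProcedures P₀ P₁ a b j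
  have hb := h.measure_iUnion_le (T := (parallelSPRT P₀ P₁ a b).T j)
    (fun n hn => (hχ.2 n hn).1) (fun n => subset_rfl) (-a)
  refine (measure_mono ?_).trans (hb.trans (mul_le_of_le_one_right' prob_le_one))
  intro ω hω
  obtain ⟨n, hn, hle⟩ := (parallelSPRT_D_eq_true_iff P₀ P₁).1 hω
  obtain ⟨m, rfl⟩ : ∃ m, n = m + 1 :=
    ⟨n - 1, by have := ((parallelSPRT_T_eq_iff P₀ P₁).1 hn).1.1; omega⟩
  exact Set.mem_iUnion.2 ⟨m, hn, neg_le_neg hle⟩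

/-- Termination is needed here, since the decision is also `false` when the test never stops; after
stopping, `λ < a` outside the interval forces `λ ≤ -b`. -/
theorem jointLaw_parallelSPRT_D_eq_false_le (hac : ∀ k, LocallyEquivalent (P₀ k) (P₁ k))
    {A : Finset (Fin K)} {i : Fin K} (hi : i ∈ A) (a b : ℝ)
    (hT : ∀ᵐ ω ∂(jointLaw P₀ P₁ A), (parallelSPRT P₀ P₁ a b).T i ω < ⊤) :
    jointLaw P₀ P₁ A {ω | (parallelSPRT P₀ P₁ a b).D i ω = false} ≤
      ENNReal.ofReal (Real.exp (-b)) := by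
  have h := isLogLikelihood_jointLaw P₀ P₁ hac hi (Finset.notMem_empty i)
  have hχ := parallelSPRT_mem_decentralizedProcedures P₀ P₁ a b i
  have hb := h.measure_iUnion_le (T := (parallelSPRT P₀ P₁ a b).T i)
    (fun n hn => (hχ.2 n hn).1) (fun n => subset_rfl) (-b)
  refine (measure_mono_ae ?_).trans (hb.trans (mul_le_of_le_one_right' prob_le_one))
  filter_upwards [hT] with ω hω hD
  have hn := (ENat.natCast_toNat hω.ne).symm
  generalize ((parallelSPRT P₀ P₁ a b).T i ω).toNat = n at hn
  obtain ⟨⟨h1, hmem⟩, -⟩ := (parallelSPRT_T_eq_iff P₀ P₁).1 hn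
  have hlt : ¬a ≤ lam (P₀ i) (P₁ i) n (ω i) := by
    rw [← parallelSPRT_D_eq_true_iff_of_T_eq P₀ P₁ hn, Bool.not_eq_true]
    exact hD
  obtain ⟨m, rfl⟩ : ∃ m, n = m + 1 := ⟨n - 1, by omega⟩
  refine Set.mem_iUnion.2 ⟨m, hn, ?_⟩
  by_contra h'
  exact hmem ⟨not_le.1 h', not_le.1 hlt⟩

theorem FWE1_parallelSPRT_le (hac : ∀ k, LocallyEquivalent (P₀ k) (P₁ k))
    (A : Finset (Fin K)) (a b : ℝ) :
    FWE1 P₀ P₁ A (parallelSPRT P₀ P₁ a b) ≤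
      ENNReal.ofReal (Aᶜ.card * Real.exp (-a)) := by
  have hsub : {ω : Paths E | ∃ j, j ∉ A ∧ (parallelSPRT P₀ P₁ a b).D j ω = true} ⊆
      ⋃ j ∈ Aᶜ, {ω | (parallelSPRT P₀ P₁ a b).D j ω = true} := by
    rintro ω ⟨j, hj, hD⟩
    exact Set.mem_biUnion (Finset.mem_compl.2 hj) hD
  refine (measure_mono hsub).trans ((measure_biUnion_finset_le _ _).trans ?_)
  refine (Finset.sum_le_card_nsmul _ _ _ fun j hj =>
    jointLaw_parallelSPRT_D_eq_true_le P₀ P₁ hac (Finset.mem_compl.1 hj) a b).trans_eq ?_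
  rw [nsmul_eq_mul, ENNReal.ofReal_mul (Nat.cast_nonneg _), ENNReal.ofReal_natCast]

theorem FWE2_parallelSPRT_le (hac : ∀ k, LocallyEquivalent (P₀ k) (P₁ k))
    (A : Finset (Fin K)) (a b : ℝ)
    (hT : ∀ k, ∀ᵐ ω ∂(jointLaw P₀ P₁ A), (parallelSPRT P₀ P₁ a b).T k ω < ⊤) :
    FWE2 P₀ P₁ A (parallelSPRT P₀ P₁ a b) ≤ ENNReal.ofReal (A.card * Real.exp (-b)) := by
  have hsub : {ω : Paths E | ∃ i, i ∈ A ∧ (parallelSPRT P₀ P₁ a b).D i ω = false} ⊆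
      ⋃ i ∈ A, {ω | (parallelSPRT P₀ P₁ a b).D i ω = false} := by
    rintro ω ⟨i, hi, hD⟩
    exact Set.mem_biUnion hi hD
  refine (measure_mono hsub).trans ((measure_biUnion_finset_le _ _).trans ?_)
  refine (Finset.sum_le_card_nsmul _ _ _ fun i hi =>
    jointLaw_parallelSPRT_D_eq_false_le P₀ P₁ hac hi a b (hT i)).trans_eq ?_
  rw [nsmul_eq_mul, ENNReal.ofReal_mul (Nat.cast_nonneg _), ENNReal.ofReal_natCast]

end Streams

/-! ### First-order asymptotics of the bounds -/

section Asymptotics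

variable {ι : Type*} {l : Filter ι}

theorem tendsto_abs_log_atTop {x : ι → ℝ} (hx : Tendsto x l (𝓝[>] 0)) :
    Tendsto (fun p => |Real.log (x p)|) l atTop :=
  tendsto_abs_atBot_atTop.comp (Real.tendsto_log_nhdsGT_zero.comp hx)

theorem tendsto_div_ofReal {w : ι → ℝ≥0∞} {r : ι → ℝ} (hr : ∀ᶠ p in l, 0 < r p)
    (hlow : ∀ δ ∈ Set.Ioo (0 : ℝ) 1, ∀ᶠ p in l, ENNReal.ofReal ((1 - δ) * r p) ≤ w p)
    (hupp : ∀ δ ∈ Set.Ioo (0 : ℝ) 1, ∀ᶠ p in l, w p ≤ ENNReal.ofReal ((1 + δ) * r p)) :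
    Tendsto (fun p => w p / ENNReal.ofReal (r p)) l (𝓝 1) := by
  rw [ENNReal.tendsto_nhds ENNReal.one_ne_top]
  intro ε hε
  -- `ε` may be infinite or large, so a real `δ < min ε 1` replaces it.
  obtain ⟨δ, hδ0, hδ⟩ := ENNReal.lt_iff_exists_nnreal_btwn.1 (lt_min hε one_pos)
  have hδ0' : (0 : ℝ) < δ := by exact_mod_cast hδ0
  have hδ1 : (δ : ℝ) < 1 := by exact_mod_cast hδ.trans_le (min_le_right _ _)
  have hδε : ENNReal.ofReal δ ≤ ε := by
    rw [ENNReal.ofReal_coe_nnreal]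
    exact (hδ.trans_le (min_le_left _ _)).le
  filter_upwards [hr, hlow δ ⟨hδ0', hδ1⟩, hupp δ ⟨hδ0', hδ1⟩] with p hp h1 h2
  have hp0 : ENNReal.ofReal (r p) ≠ 0 := (ENNReal.ofReal_pos.2 hp).ne'
  constructor
  · rw [ENNReal.le_div_iff_mul_le (Or.inl hp0) (Or.inl ENNReal.ofReal_ne_top)]
    refine le_trans ?_ h1
    rw [ENNReal.ofReal_mul (by linarith), ENNReal.ofReal_sub _ hδ0'.le, ENNReal.ofReal_one]
    gcongr
  · rw [ENNReal.div_le_iff_le_mul (Or.inl hp0) (Or.inl ENNReal.ofReal_ne_top)]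
    refine h2.trans ?_
    rw [ENNReal.ofReal_mul (by linarith), ENNReal.ofReal_add zero_le_one hδ0'.le,
      ENNReal.ofReal_one]
    gcongr

/-- With `u` the mean of the SPRT and `v` the optimum, `v ≤ u` turns a lower bound on `v` and an
upper bound on `u` into two-sided bounds on both. -/
theorem tendsto_div_of_squeeze {u v : ι → ℝ≥0∞} {r : ι → ℝ} (hr : ∀ᶠ p in l, 0 < r p)
    (hlow : ∀ δ ∈ Set.Ioo (0 : ℝ) 1, ∀ᶠ p in l, ENNReal.ofReal ((1 - δ) * r p) ≤ v p)
    (hupp : ∀ δ ∈ Set.Ioo (0 : ℝ) 1, ∀ᶠ p in l, u p ≤ ENNReal.ofReal ((1 + δ) * r p))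
    (hvu : ∀ᶠ p in l, v p ≤ u p) :
    Tendsto (fun p => u p / v p) l (𝓝 1) ∧
      Tendsto (fun p => v p / ENNReal.ofReal (r p)) l (𝓝 1) ∧
      Tendsto (fun p => u p / ENNReal.ofReal (r p)) l (𝓝 1) := by
  have hv : Tendsto (fun p => v p / ENNReal.ofReal (r p)) l (𝓝 1) :=
    tendsto_div_ofReal hr hlow fun δ hδ =>
      ((hupp δ hδ).and hvu).mono fun p hp => hp.2.trans hp.1
  have hu : Tendsto (fun p => u p / ENNReal.ofReal (r p)) l (𝓝 1) :=
    tendsto_div_ofReal hr (fun δ hδ => ((hlow δ hδ).and hvu).mono fun p hp => hp.1.trans hp.2) hupp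
  refine ⟨?_, hv, hu⟩
  have h := ENNReal.Tendsto.div hu (Or.inl one_ne_zero) hv (Or.inl ENNReal.one_ne_top)
  rw [div_one] at h
  refine h.congr' (hr.mono fun p hp => ?_)
  rw [div_eq_mul_inv (u p), div_eq_mul_inv (v p), ENNReal.mul_div_mul_right _ _
    (ENNReal.inv_ne_zero.2 ENNReal.ofReal_ne_top)
    (ENNReal.inv_ne_top.2 (ENNReal.ofReal_pos.2 hp).ne')]

variable {Ω : Type*} [mΩ : MeasurableSpace Ω] {Q R : Measure Ω} {𝓕 : ℕ → MeasurableSpace Ω}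
  {ℓ : ℕ → Ω → ℝ} {I : ℝ} {x y : ι → ℝ}

/-- Asymptotic lower bound, uniform over all tests of `R` against `Q` with error probabilities at
most `x` and `y`, for the expected decision time under `Q`. -/
theorem IsLogLikelihood.eventually_forall_le_lintegral [IsProbabilityMeasure Q]
    (h : IsLogLikelihood Q R 𝓕 ℓ) (hI : 0 < I)
    (hlim : ∀ᵐ ω ∂Q, limsup (fun n : ℕ => ((ℓ n ω / n : ℝ) : EReal)) atTop ≤ (I : EReal))
    (hx : Tendsto x l (𝓝[>] 0)) (hy : Tendsto y l (𝓝[>] 0)) {δ : ℝ} (hδ : δ ∈ Set.Ioo (0 : ℝ) 1) :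
    ∀ᶠ p in l, ∀ (T : Ω → ℕ∞) (D : Ω → Bool) (d : Bool), (∀ ω, 1 ≤ T ω) →
      (∀ n : ℕ, 1 ≤ n → MeasurableSet[𝓕 n] {ω | T ω = n} ∧
        ∀ i, MeasurableSet[𝓕 n] {ω | T ω = n ∧ D ω = i}) →
      R {ω | D ω = d} ≤ ENNReal.ofReal (x p) → Q {ω | D ω = !d} ≤ ENNReal.ofReal (y p) →
      ENNReal.ofReal ((1 - δ) * (|Real.log (x p)| / I)) ≤ ∫⁻ ω, (T ω : ℝ≥0∞) ∂Q := by
  obtain ⟨hδ0, hδ1⟩ := hδ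
  have hL := tendsto_abs_log_atTop hx
  have hr : Tendsto (fun p => |Real.log (x p)| / I) l atTop := hL.atTop_div_const hI
  -- The deficit `δ / 2` in `m` outweighs the excess `δ / 4` in the level `I * (1 + δ / 4) * m`,
  -- because `(1 + δ / 4) * (1 - δ / 2) ≤ 1 - δ / 4`.
  set m : ι → ℕ := fun p => ⌊(1 - δ / 2) * (|Real.log (x p)| / I)⌋₊ with hm
  have hmt : Tendsto m l atTop :=
    tendsto_nat_floor_atTop.comp (hr.const_mul_atTop (by linarith))
  have hI' : I < I * (1 + δ / 4) := by nlinarith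
  have hexp : Tendsto (fun p => ENNReal.ofReal (Real.exp (-(δ / 4 * |Real.log (x p)|)))) l
      (𝓝 0) := by
    rw [← ENNReal.ofReal_zero]
    refine ENNReal.tendsto_ofReal (Real.tendsto_exp_neg_atTop_nhds_zero.comp ?_)
    exact hL.const_mul_atTop (by linarith)
  have hy0 : Tendsto (fun p => ENNReal.ofReal (y p)) l (𝓝 0) := by
    rw [← ENNReal.ofReal_zero]
    exact ENNReal.tendsto_ofReal (hy.mono_right nhdsWithin_le_nhds)
  -- None of these three error terms depends on the test, which makes the bound uniform over `T`,
  -- `D` and `d`. The rate of `y` is irrelevant: it only has to vanish.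
  have herr := (((tendsto_measure_exists_le_lt h.measurable hlim hI' (hI.trans hI')).comp
    hmt).add hexp).add hy0
  rw [add_zero, add_zero] at herr
  filter_upwards [herr.eventually_le_const (ENNReal.ofReal_pos.2 (by linarith : 0 < δ / 4)),
    hr.eventually_ge_atTop (4 / δ), hx (Ioo_mem_nhdsGT one_pos)] with p hp hrp hxp T D d hT1 hT
    hxd hyd
  set r : ℝ := |Real.log (x p)| / I with hr_def
  have hLr : |Real.log (x p)| = r * I := by rw [hr_def]; field_simp
  have hxe : x p = Real.exp (-(r * I)) := by
    rw [← hLr, abs_of_neg (Real.log_neg hxp.1 hxp.2), neg_neg, Real.exp_log hxp.1]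
  have hr0 : 0 < r := lt_of_lt_of_le (by positivity) hrp
  have hm1 : (m p : ℝ) ≤ (1 - δ / 2) * r :=
    Nat.floor_le (mul_nonneg (by linarith) hr0.le)
  have hm2 : (1 - δ / 2) * r < m p + 1 := Nat.lt_floor_add_one _
  refine le_trans ?_ (h.mul_le_lintegral hT1 (fun n hn => (hT n hn).1) (fun n hn => (hT n hn).2)
    hxd hyd (m p) (I * (1 + δ / 4) * m p))
  have hcx : ENNReal.ofReal (Real.exp (I * (1 + δ / 4) * m p)) * ENNReal.ofReal (x p) ≤
      ENNReal.ofReal (Real.exp (-(δ / 4 * |Real.log (x p)|))) := by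
    rw [← ENNReal.ofReal_mul (Real.exp_pos _).le, hLr, hxe, ← Real.exp_add]
    refine ENNReal.ofReal_le_ofReal (Real.exp_le_exp.2 ?_)
    have h1 : I * (1 + δ / 4) * m p ≤ I * (1 + δ / 4) * ((1 - δ / 2) * r) := by gcongr
    have h2 : 0 ≤ I * r * (δ * δ) := by positivity
    nlinarith
  have hsum : Q {ω | ∃ n ≤ m p, I * (1 + δ / 4) * m p < ℓ n ω} +
      ENNReal.ofReal (Real.exp (I * (1 + δ / 4) * m p)) * ENNReal.ofReal (x p) +
      ENNReal.ofReal (y p) ≤ ENNReal.ofReal (δ / 4) :=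
    le_trans (by gcongr; exact le_rfl) hp
  calc ENNReal.ofReal ((1 - δ) * r)
      ≤ ENNReal.ofReal (m p * (1 - δ / 4)) := by
        refine ENNReal.ofReal_le_ofReal ?_
        -- The floor costs at most `1 ≤ δ * r / 4`, so `m ≥ (1 - 3 * δ / 4) * r`; the factor `1 - δ
        -- / 4` still leaves at least `(1 - δ) * r`.
        have h1 : 4 ≤ r * δ := (div_le_iff₀ hδ0).1 hrp
        have h2 : (1 - 3 * δ / 4) * r ≤ m p := by nlinarith
        have h3 : (1 - 3 * δ / 4) * r * (1 - δ / 4) ≤ m p * (1 - δ / 4) :=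
          mul_le_mul_of_nonneg_right h2 (by linarith)
        have h4 : 0 ≤ r * (δ * δ) := by positivity
        nlinarith
    _ = m p * (1 - ENNReal.ofReal (δ / 4)) := by
        rw [ENNReal.ofReal_mul (Nat.cast_nonneg _), ENNReal.ofReal_natCast,
          ENNReal.ofReal_sub _ (by linarith), ENNReal.ofReal_one]
    _ ≤ _ := by gcongr

/-- Asymptotic upper bound on the expectation of random times by which `ℓ` has exceeded a level
`thr ∼ |log x|`. -/
theorem eventually_lintegral_le (Q : Measure Ω) [IsProbabilityMeasure Q]
    (hℓ : ∀ n, Measurable (ℓ n)) (hI : 0 < I)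
    (hsum : ∀ ε : ℝ, 0 < ε → ∑' n : ℕ, Q {ω | ℓ (n + 1) ω / ((n + 1 : ℕ) : ℝ) ≤ I - ε} < ∞)
    (hx : Tendsto x l (𝓝[>] 0)) {thr : ι → ℝ} (hthr0 : ∀ᶠ p in l, 0 < thr p)
    (hthr : Tendsto (fun p => thr p / |Real.log (x p)|) l (𝓝 1)) {T : ι → Ω → ℕ∞}
    (hT : ∀ p ω (n : ℕ), 1 ≤ n → (n : ℕ∞) < T p ω → ℓ n ω < thr p)
    {δ : ℝ} (hδ : δ ∈ Set.Ioo (0 : ℝ) 1) :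
    ∀ᶠ p in l, ∫⁻ ω, (T p ω : ℝ≥0∞) ∂Q ≤
      ENNReal.ofReal ((1 + δ) * (|Real.log (x p)| / I)) := by
  obtain ⟨hδ0, hδ1⟩ := hδ
  have hL := tendsto_abs_log_atTop hx
  have hr : Tendsto (fun p => |Real.log (x p)| / I) l atTop := hL.atTop_div_const hI
  -- With this `I'`, `thr / I'` is at most `(1 + δ / 4) ^ 2 * r`. The constant `C + 2`, free of `p`,
  -- is eventually at most `δ * r / 4`, and the total stays below `(1 + δ) * r`.
  set I' : ℝ := I / (1 + δ / 4) with hI'_def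
  have hI' : 0 < I' := by positivity
  have hI'I : 0 < I - I' := sub_pos.2 (div_lt_self hI (by linarith))
  have hC := hsum (I - I') hI'I
  rw [sub_sub_cancel] at hC
  set C : ℝ≥0∞ := ∑' n : ℕ, Q {ω | ℓ (n + 1) ω / ((n + 1 : ℕ) : ℝ) ≤ I'} with hC_def
  filter_upwards [hthr0, hthr.eventually_le_const (show (1 : ℝ) < 1 + δ / 4 by linarith),
    hr.eventually_ge_atTop ((C.toReal + 2) / (δ / 4)), hL.eventually_gt_atTop 0]
    with p hp0 hp1 hp2 hp3
  refine (lintegral_le_of_forall_lt Q hℓ (hT p) hI' hp0.le).trans ?_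
  rw [← hC_def, ← ENNReal.ofReal_toReal hC.ne, ← ENNReal.ofReal_add (by positivity) (by positivity)]
  refine ENNReal.ofReal_le_ofReal ?_
  rw [div_le_iff₀ hp3] at hp1
  rw [div_le_iff₀ (by positivity)] at hp2
  set r : ℝ := |Real.log (x p)| / I with hr_def
  have hr0 : 0 < r := by positivity
  have h1 : thr p / I' ≤ (1 + δ / 4) * ((1 + δ / 4) * r) := by
    rw [hI'_def, div_div_eq_mul_div, hr_def, div_le_iff₀ hI]
    calc thr p * (1 + δ / 4) ≤ (1 + δ / 4) * |Real.log (x p)| * (1 + δ / 4) := by gcongr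
      _ = _ := by field_simp
  have h2 : r * (δ * δ) ≤ r * (δ * 1) := by gcongr
  nlinarith

end Asymptotics

/-! ### Asymptotic optimality and calibration -/

section Streams

variable {K : ℕ} {E : Fin K → Type*} [∀ k, MeasurableSpace (E k)]
  {P₀ P₁ : ∀ k, Measure (ℕ → E k)}
  {I J : Fin K → ℝ} {𝒜 : Finset (Finset (Fin K))}

theorem eventually_mem_Ioo_prod :
    ∀ᶠ p : ℝ × ℝ in 𝓝[>] 0 ×ˢ 𝓝[>] 0, p.1 ∈ Set.Ioo (0 : ℝ) 1 ∧ p.2 ∈ Set.Ioo (0 : ℝ) 1 :=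
  (tendsto_fst.eventually (Ioo_mem_nhdsGT one_pos)).and
    (tendsto_snd.eventually (Ioo_mem_nhdsGT one_pos))

theorem optDecentralized_le_expectedTime {a b : ℝ → ℝ → ℝ} (hab : Calibrated P₀ P₁ 𝒜 a b)
    (A : Finset (Fin K)) (k : Fin K) :
    ∀ᶠ p : ℝ × ℝ in 𝓝[>] 0 ×ˢ 𝓝[>] 0, optDecentralized P₀ P₁ 𝒜 A k p.1 p.2 ≤
      expectedTime P₀ P₁ A (parallelSPRT P₀ P₁ (a p.1 p.2) (b p.1 p.2)) k :=
  eventually_mem_Ioo_prod.mono fun p hp => iInf₂_le _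
    ⟨parallelSPRT_mem_decentralizedProcedures P₀ P₁ _ _, (hab.1 p.1 hp.1 p.2 hp.2).2.2⟩

theorem measure_le_FWE1 (χ : Procedure E) {A : Finset (Fin K)} {j : Fin K} (hj : j ∉ A) :
    jointLaw P₀ P₁ A {ω | χ.D j ω = true} ≤ FWE1 P₀ P₁ A χ :=
  measure_mono (t := {ω | ∃ j, j ∉ A ∧ χ.D j ω = true}) fun _ hω => ⟨j, hj, hω⟩

theorem measure_le_FWE2 (χ : Procedure E) {A : Finset (Fin K)} {i : Fin K} (hi : i ∈ A) :
    jointLaw P₀ P₁ A {ω | χ.D i ω = false} ≤ FWE2 P₀ P₁ A χ :=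
  measure_mono (t := {ω | ∃ i, i ∈ A ∧ χ.D i ω = false}) fun _ hω => ⟨i, hi, hω⟩

variable [∀ k, IsProbabilityMeasure (P₀ k)] [∀ k, IsProbabilityMeasure (P₁ k)]

/-- Declaring `i` a signal is a type-I error under `B` and failing to do so a type-II error under
`A`, so the general lower bound applies with `x = α`, `y = β`. -/
theorem eventually_le_optDecentralized_of_mem (hac : ∀ k, LocallyEquivalent (P₀ k) (P₁ k))
    (hI : ∀ k, 0 < I k) (hlimsup : ∀ k, LimsupBound (P₀ k) (P₁ k) (I k) (J k))
    {A B : Finset (Fin K)} (hA : A ∈ 𝒜) (hB : B ∈ 𝒜) {i : Fin K} (hiA : i ∈ A) (hiB : i ∉ B)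
    {δ : ℝ} (hδ : δ ∈ Set.Ioo (0 : ℝ) 1) :
    ∀ᶠ p : ℝ × ℝ in 𝓝[>] 0 ×ˢ 𝓝[>] 0,
      ENNReal.ofReal ((1 - δ) * (|Real.log p.1| / I i)) ≤
        optDecentralized P₀ P₁ 𝒜 A i p.1 p.2 := by
  filter_upwards [(isLogLikelihood_jointLaw P₀ P₁ hac hiA hiB).eventually_forall_le_lintegral
    (hI i) ((measurePreserving_jointLaw_of_mem P₀ P₁ hiA).quasiMeasurePreserving.ae (hlimsup i).1)
    tendsto_fst tendsto_snd hδ] with p hp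
  refine le_iInf₂ fun χ hχ => hp (χ.T i) (χ.D i) true (hχ.1 i).1 (hχ.1 i).2 ?_ ?_
  · exact (measure_le_FWE1 χ hiB).trans (hχ.2.2 B hB).2.1
  · exact (measure_le_FWE2 χ hiA).trans (hχ.2.2 A hA).2.2

/-- The mirror image: `-λ` is the log-likelihood, declaring noise is the error under `B`, and `x =
β`, `y = α`. -/
theorem eventually_le_optDecentralized_of_notMem (hac : ∀ k, LocallyEquivalent (P₀ k) (P₁ k))
    (hJ : ∀ k, 0 < J k) (hlimsup : ∀ k, LimsupBound (P₀ k) (P₁ k) (I k) (J k))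
    {A B : Finset (Fin K)} (hA : A ∈ 𝒜) (hB : B ∈ 𝒜) {j : Fin K} (hjA : j ∉ A) (hjB : j ∈ B)
    {δ : ℝ} (hδ : δ ∈ Set.Ioo (0 : ℝ) 1) :
    ∀ᶠ p : ℝ × ℝ in 𝓝[>] 0 ×ˢ 𝓝[>] 0,
      ENNReal.ofReal ((1 - δ) * (|Real.log p.2| / J j)) ≤
        optDecentralized P₀ P₁ 𝒜 A j p.1 p.2 := by
  filter_upwards [(isLogLikelihood_neg_jointLaw P₀ P₁ hac hjB hjA).eventually_forall_le_lintegral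
    (hJ j)
    ((measurePreserving_jointLaw_of_notMem P₀ P₁ hjA).quasiMeasurePreserving.ae (hlimsup j).2)
    tendsto_snd tendsto_fst hδ] with p hp
  refine le_iInf₂ fun χ hχ => hp (χ.T j) (χ.D j) false (hχ.1 j).1 (hχ.1 j).2 ?_ ?_
  · exact (measure_le_FWE2 χ hjB).trans (hχ.2.2 B hB).2.2
  · exact (measure_le_FWE1 χ hjA).trans (hχ.2.2 A hA).2.1

/-- The lower threshold can only make the test stop sooner, so `b` does not enter and no relation
between `α` and `β` is needed. -/
theorem eventually_expectedTime_le_of_mem (hac : ∀ k, LocallyEquivalent (P₀ k) (P₁ k))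
    (hI : ∀ k, 0 < I k) (hcomplete : ∀ k, CompleteLowerConvergence (P₀ k) (P₁ k) (I k) (J k))
    {a b : ℝ → ℝ → ℝ} (hab : Calibrated P₀ P₁ 𝒜 a b) {A : Finset (Fin K)} {i : Fin K}
    (hi : i ∈ A) {δ : ℝ} (hδ : δ ∈ Set.Ioo (0 : ℝ) 1) :
    ∀ᶠ p : ℝ × ℝ in 𝓝[>] 0 ×ˢ 𝓝[>] 0,
      expectedTime P₀ P₁ A (parallelSPRT P₀ P₁ (a p.1 p.2) (b p.1 p.2)) i ≤
        ENNReal.ofReal ((1 + δ) * (|Real.log p.1| / I i)) :=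
  eventually_lintegral_le (ℓ := fun n (ω : Paths E) => lam (P₀ i) (P₁ i) n (ω i))
    (jointLaw P₀ P₁ A)
    (isLogLikelihood_jointLaw P₀ P₁ hac hi (Finset.notMem_empty i)).measurable (hI i)
    (fun _ hε => tsum_jointLaw_lt_top_of_mem hcomplete hi hε) tendsto_fst
    (eventually_mem_Ioo_prod.mono fun p hp => (hab.1 p.1 hp.1 p.2 hp.2).1) hab.2.1
    (T := fun p => (parallelSPRT P₀ P₁ (a p.1 p.2) (b p.1 p.2)).T i)
    (fun _ _ _ hn h => (mem_Ioo_of_lt_parallelSPRT_T P₀ P₁ hn h).2) hδ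

theorem eventually_expectedTime_le_of_notMem (hac : ∀ k, LocallyEquivalent (P₀ k) (P₁ k))
    (hJ : ∀ k, 0 < J k) (hcomplete : ∀ k, CompleteLowerConvergence (P₀ k) (P₁ k) (I k) (J k))
    {a b : ℝ → ℝ → ℝ} (hab : Calibrated P₀ P₁ 𝒜 a b) {A : Finset (Fin K)} {j : Fin K}
    (hj : j ∉ A) {δ : ℝ} (hδ : δ ∈ Set.Ioo (0 : ℝ) 1) :
    ∀ᶠ p : ℝ × ℝ in 𝓝[>] 0 ×ˢ 𝓝[>] 0,
      expectedTime P₀ P₁ A (parallelSPRT P₀ P₁ (a p.1 p.2) (b p.1 p.2)) j ≤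
        ENNReal.ofReal ((1 + δ) * (|Real.log p.2| / J j)) :=
  eventually_lintegral_le (ℓ := fun n (ω : Paths E) => -lam (P₀ j) (P₁ j) n (ω j))
    (jointLaw P₀ P₁ A)
    (isLogLikelihood_neg_jointLaw P₀ P₁ hac (Finset.mem_univ j) hj).measurable (hJ j)
    (fun _ hε => tsum_jointLaw_lt_top_of_notMem hcomplete hj hε) tendsto_snd
    (eventually_mem_Ioo_prod.mono fun p hp => (hab.1 p.1 hp.1 p.2 hp.2).2.1) hab.2.2
    (T := fun p => (parallelSPRT P₀ P₁ (a p.1 p.2) (b p.1 p.2)).T j)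
    (fun _ _ _ hn h => neg_lt.1 (mem_Ioo_of_lt_parallelSPRT_T P₀ P₁ hn h).1) hδ

theorem eventually_div_pos {ι : Type*} {l : Filter ι} {x : ι → ℝ} (hx : Tendsto x l (𝓝[>] 0))
    {c : ℝ} (hc : 0 < c) : ∀ᶠ p in l, 0 < |Real.log (x p)| / c :=
  ((tendsto_abs_log_atTop hx).eventually_gt_atTop 0).mono fun _ hp => div_pos hp hc

theorem tendsto_abs_log_add_div {ι : Type*} {l : Filter ι} {x : ι → ℝ}
    (hx : Tendsto x l (𝓝[>] 0)) (c : ℝ) :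
    Tendsto (fun p => (|Real.log (x p)| + c) / |Real.log (x p)|) l (𝓝 1) := by
  have hL := tendsto_abs_log_atTop hx
  have h : Tendsto (fun p => 1 + c / |Real.log (x p)|) l (𝓝 (1 + 0)) :=
    tendsto_const_nhds.add (hL.const_div_atTop c)
  rw [add_zero] at h
  refine h.congr' ((hL.eventually_gt_atTop 0).mono fun p hp => ?_)
  simp only [add_div, div_self hp.ne']

/-- The Bonferroni correction of a threshold bounds the sum of at most `s` error probabilities. -/
theorem natCast_mul_exp_neg_le {n s : ℕ} (hns : n ≤ s) {α : ℝ} (hα : α ∈ Set.Ioo (0 : ℝ) 1) :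
    (n : ℝ) * Real.exp (-(|Real.log α| + Real.log s)) ≤ α := by
  -- For `s = 0` there is no error to control, and `Real.log 0 = 0` leaves the threshold at `|log
  -- α|`.
  rcases Nat.eq_zero_or_pos s with rfl | hs
  · obtain rfl : n = 0 := by omega
    simpa using hα.1.le
  · have hs' : (0 : ℝ) < s := by exact_mod_cast hs
    rw [abs_of_neg (Real.log_neg hα.1 hα.2), neg_add, neg_neg, Real.exp_add, Real.exp_log hα.1,
      Real.exp_neg, Real.exp_log hs', ← mul_assoc, mul_comm (n : ℝ) α, mul_assoc]
    refine mul_le_of_le_one_right hα.1.le ?_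
    rw [← div_eq_mul_inv]
    exact div_le_one_of_le₀ (by exact_mod_cast hns) hs'.le

/-- The correction is the logarithm of a natural number, hence nonnegative (also at `0`), so the
thresholds are positive; being constant, it is negligible against `|log α|` and `|log β|`. -/
theorem calibrated_bonferroni (hac : ∀ k, LocallyEquivalent (P₀ k) (P₁ k))
    (hI : ∀ k, 0 < I k) (hJ : ∀ k, 0 < J k)
    (hcomplete : ∀ k, CompleteLowerConvergence (P₀ k) (P₁ k) (I k) (J k))
    (𝒜 : Finset (Finset (Fin K))) :
    Calibrated P₀ P₁ 𝒜
      (fun α _ => |Real.log α| + Real.log (𝒜.sup fun A => Aᶜ.card : ℕ))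
      (fun _ β => |Real.log β| + Real.log (𝒜.sup fun A => A.card : ℕ)) := by
  have hpos : ∀ α ∈ Set.Ioo (0 : ℝ) 1, ∀ s : ℕ, 0 < |Real.log α| + Real.log s := fun α hα s =>
    add_pos_of_pos_of_nonneg (abs_pos.2 (Real.log_neg hα.1 hα.2).ne) (Real.log_natCast_nonneg s)
  refine ⟨fun α hα β hβ => ⟨hpos α hα _, hpos β hβ _,
    decentralizedProcedures_subset (parallelSPRT_mem_decentralizedProcedures P₀ P₁ _ _),
    fun A hA => ?_⟩, tendsto_abs_log_add_div tendsto_fst _, tendsto_abs_log_add_div tendsto_snd _⟩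
  have hT := parallelSPRT_T_lt_top P₀ P₁ hI hJ hcomplete A
    (|Real.log α| + Real.log (𝒜.sup fun A => Aᶜ.card : ℕ))
    (|Real.log β| + Real.log (𝒜.sup fun A => A.card : ℕ))
  refine ⟨hT, (FWE1_parallelSPRT_le P₀ P₁ hac A _ _).trans (ENNReal.ofReal_le_ofReal ?_),
    (FWE2_parallelSPRT_le P₀ P₁ hac A _ _ hT).trans (ENNReal.ofReal_le_ofReal ?_)⟩
  · exact natCast_mul_exp_neg_le (Finset.le_sup (f := fun A : Finset (Fin K) => Aᶜ.card) hA) hα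
  · exact natCast_mul_exp_neg_le (Finset.le_sup (f := fun A : Finset (Fin K) => A.card) hA) hβ

end Streams

end MultiTest

theorem theorem4p2 {K : ℕ} {E : Fin K → Type*} [∀ k, MeasurableSpace (E k)]
    (P₀ P₁ : ∀ k, Measure (ℕ → E k))
    [∀ k, IsProbabilityMeasure (P₀ k)] [∀ k, IsProbabilityMeasure (P₁ k)]
    (hac : ∀ k, LocallyEquivalent (P₀ k) (P₁ k))
    (I J : Fin K → ℝ) (hI : ∀ k, 0 < I k) (hJ : ∀ k, 0 < J k)
    (hlimsup : ∀ k, LimsupBound (P₀ k) (P₁ k) (I k) (J k))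
    (hcomplete : ∀ k, CompleteLowerConvergence (P₀ k) (P₁ k) (I k) (J k))
    (𝒜 : Finset (Finset (Fin K)))
    (h𝒜 : ∀ k, ∃ A ∈ 𝒜, ∃ B ∈ 𝒜, k ∈ A ∧ k ∉ B) :
    -- asymptotic optimality among decentralized procedures, for all admissible thresholds
    (∀ a b : ℝ → ℝ → ℝ, Calibrated P₀ P₁ 𝒜 a b →
      (∀ α ∈ Set.Ioo (0 : ℝ) 1, ∀ β ∈ Set.Ioo (0 : ℝ) 1,
        parallelSPRT P₀ P₁ (a α β) (b α β) ∈
          decentralizedProcedures E ∩ controlledProcedures P₀ P₁ 𝒜 α β) ∧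
      ∀ A ∈ 𝒜,
        (∀ i ∈ A,
          AsympEq (fun α β => expectedTime P₀ P₁ A (parallelSPRT P₀ P₁ (a α β) (b α β)) i)
            (fun α β => optDecentralized P₀ P₁ 𝒜 A i α β) ∧
          AsympEq (fun α β => optDecentralized P₀ P₁ 𝒜 A i α β)
            (fun α _ => ENNReal.ofReal (|Real.log α| / I i)) ∧
          AsympEq (fun α β => expectedTime P₀ P₁ A (parallelSPRT P₀ P₁ (a α β) (b α β)) i)
            (fun α _ => ENNReal.ofReal (|Real.log α| / I i))) ∧
        (∀ j ∉ A,
          AsympEq (fun α β => expectedTime P₀ P₁ A (parallelSPRT P₀ P₁ (a α β) (b α β)) j)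
            (fun α β => optDecentralized P₀ P₁ 𝒜 A j α β) ∧
          AsympEq (fun α β => optDecentralized P₀ P₁ 𝒜 A j α β)
            (fun _ β => ENNReal.ofReal (|Real.log β| / J j)) ∧
          AsympEq (fun α β => expectedTime P₀ P₁ A (parallelSPRT P₀ P₁ (a α β) (b α β)) j)
            (fun _ β => ENNReal.ofReal (|Real.log β| / J j)))) ∧
    -- an explicit choice of admissible thresholds
    Calibrated P₀ P₁ 𝒜
      (fun α _ => |Real.log α| + Real.log (𝒜.sup fun A => Aᶜ.card : ℕ))
      (fun _ β => |Real.log β| + Real.log (𝒜.sup fun A => A.card : ℕ)) := by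
  refine ⟨fun a b hab => ⟨fun α hα β hβ =>
    ⟨parallelSPRT_mem_decentralizedProcedures P₀ P₁ _ _, (hab.1 α hα β hβ).2.2⟩,
    fun A hA => ⟨fun i hi => ?_, fun j hj => ?_⟩⟩, calibrated_bonferroni hac hI hJ hcomplete 𝒜⟩
  -- `A` itself is a configuration containing `i`; only one omitting it has to be supplied.
  · obtain ⟨-, -, B, hB, -, hiB⟩ := h𝒜 i
    exact tendsto_div_of_squeeze (eventually_div_pos tendsto_fst (hI i))
      (fun δ hδ => eventually_le_optDecentralized_of_mem hac hI hlimsup hA hB hi hiB hδ)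
      (fun δ hδ => eventually_expectedTime_le_of_mem hac hI hcomplete hab hi hδ)
      (optDecentralized_le_expectedTime hab A i)
  · obtain ⟨B, hB, -, -, hjB, -⟩ := h𝒜 j
    exact tendsto_div_of_squeeze (eventually_div_pos tendsto_snd (hJ j))
      (fun δ hδ => eventually_le_optDecentralized_of_notMem hac hJ hlimsup hA hB hj hjB hδ)
      (fun δ hδ => eventually_expectedTime_le_of_notMem hac hJ hcomplete hab hj hδ)
      (optDecentralized_le_expectedTime hab A j)
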